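/- Let $\{0,1\}^*$ be the set of finite binary strings and let $l(y)$ denote the length of $y$. A (plain) decompressor is a computable partial function $D\colon\{0,1\}^*\to\{0,1\}^*$. For $x\in\{0,1\}^*$ put $C_D(x)=\min\{l(y) : D(y)=x\}$, with $C_D(x)=\infty$ if there is no such $y$. A decompressor is prefix-free if no string in its domain is a proper prefix of another string in its domain. A plain decompressor $D$ is optimal if for every plain decompressor $D'$ there is a constant $c$ such that $C_D(x)\le C_{D'}(x)+c$ for all $x$. A prefix-free decompressor $V$ is an optimal prefix-free decompressor if for every prefix-free decompressor $V'$ there is a constant $c$ such that $C_V(x)\le C_{V'}(x)+c$ for all $x$. **Theorem 1.** There exists an optimal plain decompressor $D$, with domain $S$, such that no set $T\subseteq S$ is the domain of an optimal prefix-free decompressor. -/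

import Mathlib

/-- Finite binary strings. -/
abbrev BinString : Type := List Bool

/-- A (plain) decompressor is a computable partial function from binary strings to
binary strings. -/
def IsDecompressor (D : BinString →. BinString) : Prop :=
  Partrec D

/-- The complexity of `x` with respect to `D`: the length of a shortest `D`-description
of `x`, with value `⊤` if `x` has no `D`-description. -/
noncomputable def descComplexity (D : BinString →. BinString) (x : BinString) : ℕ∞ :=
  ⨅ y ∈ {y : BinString | x ∈ D y}, (y.length : ℕ∞)

/-- A set of strings is prefix-free if no element is a proper prefix of another element. -/
def IsPrefixFreeSet (S : Set BinString) : Prop :=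
  ∀ u ∈ S, ∀ v ∈ S, u <+: v → u = v

/-- A decompressor with prefix-free domain. -/
def IsPrefixFreeDecompressor (D : BinString →. BinString) : Prop :=
  IsDecompressor D ∧ IsPrefixFreeSet D.Dom

/-- A plain decompressor whose complexity is minimal, up to an additive constant, among
all plain decompressors. -/
def IsOptimalDecompressor (D : BinString →. BinString) : Prop :=
  IsDecompressor D ∧
    ∀ D' : BinString →. BinString, IsDecompressor D' →
      ∃ c : ℕ, ∀ x : BinString, descComplexity D x ≤ descComplexity D' x + c

/-- A prefix-free decompressor whose complexity is minimal, up to an additive constant,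
among all prefix-free decompressors. -/
def IsOptimalPrefixFreeDecompressor (V : BinString →. BinString) : Prop :=
  IsPrefixFreeDecompressor V ∧
    ∀ V' : BinString →. BinString, IsPrefixFreeDecompressor V' →
      ∃ c : ℕ, ∀ x : BinString, descComplexity V x ≤ descComplexity V' x + c

/-! Each program faces infinitely many games `e`. Lengths are cut into bands [s², (s+1)²), and band
s belongs to game `s.unpair.1`. There the domain is confined to extensions of the game's live
candidates, or, if these cover less than half of the strings, to the uncovered strings; in the
latter case all uncovered strings of length (s+1)² become candidates. At least half of the strings
of each length survive, so one extra bit suffices to recode a universal machine.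

Suppose an optimal prefix-free `V` has its domain inside. It must use every late band, which kills
live candidates until coverage is sparse, so candidates appear at infinitely many lengths
(`exists_isSpecial`). Live candidates form a prefix-free set, so by Kraft's inequality some
candidate length n keeps only a tiny fraction of its strings live (`exists_isDepleted`). Then
`V.Dom` has fewer than 2^(n-2e) elements shorter than n (`IsDepleted.card_lt`). But n - 2e is
computable from `e`, so optimality yields 2^(n-2e) descriptions of length at most n - e + O(1)
(`exists_many_short`), which is absurd for large `e`. -/

section

/-! ### Counting strings and coverings -/

/-- All binary strings of length `n`. -/
def strings : ℕ → List BinString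
  | 0 => [[]]
  | n + 1 => (strings n).flatMap fun x => [x ++ [false], x ++ [true]]

theorem mem_strings {n : ℕ} {x : BinString} : x ∈ strings n ↔ x.length = n := by
  induction n generalizing x with
  | zero => simp [strings]
  | succ n ih =>
    simp only [strings, List.mem_flatMap, ih]
    constructor
    · rintro ⟨a, ha, hx⟩
      simp only [List.mem_cons, List.not_mem_nil, or_false] at hx
      rcases hx with rfl | rfl <;> simp [ha]
    · intro hx
      have hne : x ≠ [] := by rintro rfl; simp at hx
      refine ⟨x.dropLast, by simp [hx], ?_⟩
      have h := List.dropLast_append_getLast hne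
      rcases hb : x.getLast hne with _ | _ <;> rw [hb] at h <;> simp [h]

theorem length_strings (n : ℕ) : (strings n).length = 2 ^ n := by
  induction n with
  | zero => simp [strings]
  | succ n ih => simp [strings, ih, pow_succ]

theorem nodup_strings (n : ℕ) : (strings n).Nodup := by
  induction n with
  | zero => simp [strings]
  | succ n ih =>
    rw [strings, List.nodup_flatMap]
    refine ⟨fun x _ => by simp, ih.imp fun {a b} hab => ?_⟩
    simp [Function.onFun, List.disjoint_left, hab]

theorem card_filter_strings (n : ℕ) (P : BinString → Prop) [DecidablePred P] :
    {x ∈ (strings n).toFinset | P x}.card = ((strings n).filter (P ·)).length := by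
  rw [← List.toFinset_card_of_nodup ((nodup_strings n).filter _), List.toFinset_filter]
  simp

/-- Beyond length `m` further bits do not affect `P`, so each bit doubles the count: density is
constant. -/
theorem length_filter_strings_add (P : BinString → Prop) [DecidablePred P] {m : ℕ}
    (hP : ∀ x b, m ≤ x.length → (P (x ++ [b]) ↔ P x)) (k : ℕ) :
    ((strings (m + k)).filter (P ·)).length = 2 ^ k * ((strings m).filter (P ·)).length := by
  induction k with
  | zero => simp
  | succ k ih =>
    rw [pow_succ, mul_right_comm, ← ih, ← add_assoc, strings]
    have : ∀ l : List BinString, (∀ x ∈ l, m ≤ x.length) →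
        ((l.flatMap fun x => [x ++ [false], x ++ [true]]).filter (P ·)).length
          = (l.filter (P ·)).length * 2 := by
      intro l hl
      induction l with
      | nil => simp
      | cons a l ihl =>
        have ha := fun b => hP a b (hl a (by simp))
        have hl' := ihl fun x hx => hl x (by simp [hx])
        by_cases h : P a <;> simp_all
        omega
    exact this _ fun x hx => by rw [mem_strings] at hx; omega

theorem card_le_of_length_lt (s : Finset BinString) {n : ℕ} (hs : ∀ x ∈ s, x.length < n) :
    s.card < 2 ^ n := by
  have hsub : s ⊆ (Finset.range n).biUnion fun i => (strings i).toFinset := by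
    intro x hx
    simpa [mem_strings] using hs x hx
  have hcard : ∀ i, (strings i).toFinset.card = 2 ^ i := fun i => by
    rw [List.toFinset_card_of_nodup (nodup_strings i), length_strings]
  calc s.card ≤ ∑ i ∈ Finset.range n, 2 ^ i := by
        refine (Finset.card_le_card hsub).trans (Finset.card_biUnion_le.trans ?_)
        simp [hcard]
    _ < 2 ^ n := by
        have := Nat.geomSum_eq (le_refl 2) n
        have := Nat.one_le_two_pow (n := n)
        omega

def HasPrefixIn (l : List BinString) (x : BinString) : Prop := ∃ u ∈ l, u <+: x

def HasExtensionIn (l : List BinString) (u : BinString) : Prop := ∃ z ∈ l, u <+: z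

instance (l : List BinString) : DecidablePred (HasPrefixIn l) :=
  fun x => inferInstanceAs (Decidable (∃ u ∈ l, u <+: x))

instance (l : List BinString) : DecidablePred (HasExtensionIn l) :=
  fun u => inferInstanceAs (Decidable (∃ z ∈ l, u <+: z))

theorem prefix_append_of_length_le {u x t : BinString} (h : u.length ≤ x.length) :
    u <+: x ++ t ↔ u <+: x :=
  ⟨fun hu => List.prefix_of_prefix_length_le hu (List.prefix_append x t) h,
    fun hu => hu.trans (List.prefix_append x t)⟩

theorem hasPrefixIn_append {l : List BinString} {x : BinString} (t : BinString)
    (hl : ∀ u ∈ l, u.length ≤ x.length) : HasPrefixIn l (x ++ t) ↔ HasPrefixIn l x :=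
  exists_congr fun _ => and_congr_right fun hu => prefix_append_of_length_le (hl _ hu)

/-- The set of `l`-covered strings has density less than one half at length `n`. -/
def IsSparse (n : ℕ) (l : List BinString) : Prop :=
  2 * ((strings n).filter (HasPrefixIn l ·)).length < 2 ^ n

instance (n : ℕ) (l : List BinString) : Decidable (IsSparse n l) :=
  inferInstanceAs (Decidable (_ < _))

/-- The members of `c` that have no extension in `l`. -/
def unblocked (c l : List BinString) : List BinString :=
  c.filter fun u => ¬ HasExtensionIn l u

theorem mem_unblocked {c l : List BinString} {u : BinString} :
    u ∈ unblocked c l ↔ u ∈ c ∧ ¬ HasExtensionIn l u := by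
  simp [unblocked]

/-! ### The games and the playable set -/

variable (E : ℕ → ℕ → List BinString)

/-- The strings played in game `e` before stage `s`. -/
def candidates (e : ℕ) : ℕ → List BinString
  | 0 => []
  | s + 1 =>
    if s.unpair.1 = e ∧ IsSparse (s ^ 2) (unblocked (candidates e s) (E e s)) then
      candidates e s ++ (strings ((s + 1) ^ 2)).filter
        fun x => ¬ HasPrefixIn (unblocked (candidates e s) (E e s)) x
    else candidates e s

/-- The strings played in game `e` before stage `s` that the opponent has not yet blocked. -/
def live (e s : ℕ) : List BinString := unblocked (candidates E e s) (E e s)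

/-- The set from which the domain of the plain decompressor is formed: at stage `s` the
strings of length from `s ^ 2` to `(s + 1) ^ 2 - 1` are treated, and either those covered by live
strings are kept or all the others. -/
def Playable (y : BinString) : Prop :=
  IsSparse (y.length.sqrt ^ 2) (live E y.length.sqrt.unpair.1 y.length.sqrt) ↔
    ¬ HasPrefixIn (live E y.length.sqrt.unpair.1 y.length.sqrt) y

instance : DecidablePred (Playable E) := fun _ => inferInstanceAs (Decidable (_ ↔ _))

def IsSpecial (e s : ℕ) : Prop := s.unpair.1 = e ∧ IsSparse (s ^ 2) (live E e s)

instance (e s : ℕ) : Decidable (IsSpecial E e s) := inferInstanceAs (Decidable (_ ∧ _))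

variable {E}

theorem candidates_succ_of_isSpecial {e s : ℕ} (h : IsSpecial E e s) :
    candidates E e (s + 1) = candidates E e s ++
      (strings ((s + 1) ^ 2)).filter fun x => ¬ HasPrefixIn (live E e s) x :=
  if_pos h

theorem candidates_succ_of_not_isSpecial {e s : ℕ} (h : ¬ IsSpecial E e s) :
    candidates E e (s + 1) = candidates E e s :=
  if_neg h

theorem mem_candidates {e s : ℕ} {u : BinString} :
    u ∈ candidates E e s ↔ ∃ j < s, IsSpecial E e j ∧ u.length = (j + 1) ^ 2 ∧
      ¬ HasPrefixIn (live E e j) u := by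
  induction s with
  | zero => simp [candidates]
  | succ s ih =>
    rw [Nat.exists_lt_succ_right, ← ih]
    by_cases h : IsSpecial E e s
    · simp [candidates_succ_of_isSpecial h, mem_strings, h]
    · simp [candidates_succ_of_not_isSpecial h, h]

theorem candidates_mono {e s t : ℕ} (h : s ≤ t) {u : BinString} (hu : u ∈ candidates E e s) :
    u ∈ candidates E e t := by
  rw [mem_candidates] at *
  obtain ⟨j, hj, h'⟩ := hu
  exact ⟨j, hj.trans_le h, h'⟩

theorem length_le_of_mem_live {e s : ℕ} {u : BinString} (hu : u ∈ live E e s) :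
    u.length ≤ s ^ 2 := by
  obtain ⟨j, hj, -, h, -⟩ := mem_candidates.1 (mem_unblocked.1 hu).1
  rw [h]
  gcongr
  omega

theorem playable_iff {y : BinString} {s : ℕ} (h₁ : s ^ 2 ≤ y.length) (h₂ : y.length < (s + 1) ^ 2) :
    Playable E y ↔ (IsSparse (s ^ 2) (live E s.unpair.1 s) ↔ ¬ HasPrefixIn (live E s.unpair.1 s) y) := by
  have : y.length.sqrt = s := by
    symm; rw [Nat.eq_sqrt]; constructor <;> nlinarith
  rw [Playable, this]

/-- Live strings at stage s have length at most s², so coverage has the same density throughout the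
band; the rule keeps a side of density at least one half. -/
theorem two_pow_le_length_filter_playable (n : ℕ) :
    2 ^ n ≤ 2 * ((strings n).filter (Playable E ·)).length := by
  obtain ⟨s, hs⟩ : ∃ s, s = n.sqrt := ⟨_, rfl⟩
  have h₁ : s ^ 2 ≤ n := by rw [hs]; exact Nat.sqrt_le' n
  have h₂ : n < (s + 1) ^ 2 := by rw [hs]; exact Nat.lt_succ_sqrt' n
  obtain ⟨k, rfl⟩ := Nat.exists_eq_add_of_le h₁
  set l := live E s.unpair.1 s with hl
  have hcov := length_filter_strings_add (HasPrefixIn l) (m := s ^ 2) (fun x b hx =>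
    hasPrefixIn_append [b] fun u hu => (length_le_of_mem_live hu).trans hx) k
  have hcompl := List.length_eq_length_filter_add (l := strings (s ^ 2 + k))
    (fun x => decide (HasPrefixIn l x))
  have heq : (strings (s ^ 2 + k)).filter (Playable E ·) =
      (strings (s ^ 2 + k)).filter fun x => decide (IsSparse (s ^ 2) l ↔ ¬ HasPrefixIn l x) := by
    refine List.filter_congr fun x hx => ?_
    rw [mem_strings] at hx
    simp only [decide_eq_decide]
    exact playable_iff (by omega) (by omega)
  rw [heq]
  rw [length_strings] at hcompl
  by_cases hsp : IsSparse (s ^ 2) l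
  · have hsp' := hsp
    simp only [IsSparse] at hsp'
    simp only [hsp, true_iff, decide_not]
    have := Nat.mul_lt_mul_of_pos_left hsp' (Nat.two_pow_pos k)
    rw [pow_add] at hcompl ⊢
    nlinarith
  · have hsp' := hsp
    simp only [IsSparse, not_lt] at hsp'
    simp only [hsp, false_iff, not_not]
    have := Nat.mul_le_mul_left (2 ^ k) hsp'
    rw [pow_add]
    nlinarith

end

/-! ### Special stages, depletion and the short strings of a prefix-free set -/

section

variable {E : ℕ → ℕ → List BinString} {e : ℕ}

theorem mem_live_of_le (hmono : ∀ s t, s ≤ t → E e s ⊆ E e t) {s t : ℕ} (h : s ≤ t)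
    {u : BinString} (hu : u ∈ candidates E e s) (hu' : u ∈ live E e t) : u ∈ live E e s := by
  refine mem_unblocked.2 ⟨hu, fun ⟨z, hz, huz⟩ => (mem_unblocked.1 hu').2 ⟨z, hmono s t h hz, huz⟩⟩

/-- Blocking is permanent, so `u` was already live when the longer `v` was added, and only uncovered
strings are added. -/
theorem not_prefix_of_mem_live (hmono : ∀ s t, s ≤ t → E e s ⊆ E e t) {s : ℕ}
    {u v : BinString} (hu : u ∈ live E e s) (hv : v ∈ live E e s) (hlt : u.length < v.length) :
    ¬ u <+: v := by
  intro huv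
  obtain ⟨i, hi, hisp, hui, hucov⟩ := mem_candidates.1 (mem_unblocked.1 hu).1
  obtain ⟨j, hj, hjsp, hvj, hvcov⟩ := mem_candidates.1 (mem_unblocked.1 hv).1
  have hij : i < j := by
    rw [hui, hvj] at hlt
    have := lt_of_pow_lt_pow_left₀ 2 (by omega) hlt
    omega
  exact hvcov ⟨u, mem_live_of_le hmono hj.le (mem_candidates.2 ⟨i, hij, hisp, hui, hucov⟩) hu, huv⟩

theorem candidates_eq_of_not_isSpecial {s t : ℕ} (h : ∀ r ≥ s, ¬ IsSpecial E e r) (hst : s ≤ t) :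
    candidates E e t = candidates E e s := by
  induction t, hst using Nat.le_induction with
  | base => rfl
  | succ t hst ih => rw [candidates_succ_of_not_isSpecial (h t hst), ih]

theorem unblocked_sublist {c l l' : List BinString} (h : l ⊆ l') :
    (unblocked c l').Sublist (unblocked c l) := by
  refine List.monotone_filter_right _ fun u hu => ?_
  simp only [decide_eq_true_eq] at hu ⊢
  exact fun ⟨z, hz, huz⟩ => hu ⟨z, h hz, huz⟩

theorem exists_stage (e n : ℕ) : ∃ s ≥ n, s.unpair.1 = e :=
  ⟨Nat.pair e n, Nat.right_le_pair e n, by simp⟩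

/-- Without further special stages the candidates are frozen, and each stage of the game makes `T`
use an extension of a live one, which then dies. The finite number of live candidates cannot
decrease forever. -/
theorem exists_isSpecial {T : Set BinString} (hmono : ∀ s t, s ≤ t → E e s ⊆ E e t)
    (hlim : ∀ z ∈ T, ∃ s, z ∈ E e s) (hplay : ∀ z ∈ T, Playable E z)
    (hband : ∀ s ≥ e, ∃ z ∈ T, s ^ 2 ≤ z.length ∧ z.length < (s + 1) ^ 2) (s : ℕ) :
    ∃ r ≥ s, IsSpecial E e r := by
  by_contra! h
  have hsub : ∀ {t t'}, s ≤ t → t ≤ t' → (live E e t').Sublist (live E e t) := by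
    intro t t' ht ht'
    unfold live
    rw [candidates_eq_of_not_isSpecial h ht, candidates_eq_of_not_isSpecial h (ht.trans ht')]
    exact unblocked_sublist (hmono t t' ht')
  suffices ∀ m, ∀ t ≥ s, (live E e t).length ≠ m from this _ s le_rfl rfl
  intro m
  induction m using Nat.strong_induction_on with
  | _ m ih =>
    intro t ht hm
    obtain ⟨r, hr, hre⟩ := exists_stage e t
    have her : e ≤ r := hre ▸ Nat.unpair_left_le r
    obtain ⟨z, hz, hz₁, hz₂⟩ := hband r her
    have hcov : HasPrefixIn (live E e r) z := by
      have h₁ := (playable_iff hz₁ hz₂).1 (hplay z hz)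
      rw [hre] at h₁
      have h₂ : ¬ IsSparse (r ^ 2) (live E e r) := fun h₂ => h r (ht.trans hr) ⟨hre, h₂⟩
      exact not_not.1 fun h₃ => h₂ (h₁.2 h₃)
    obtain ⟨u, hu, huz⟩ := hcov
    obtain ⟨q, hq⟩ := hlim z hz
    have hsr := ht.trans hr
    have hle := hsub hsr (le_max_left r q)
    have hlt : (live E e (max r q)).length < (live E e r).length := by
      refine lt_of_le_of_ne hle.length_le fun heq => ?_
      rw [← hle.eq_of_length heq] at hu
      exact (mem_unblocked.1 hu).2 ⟨z, hmono q _ (le_max_right r q) hq, huz⟩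
    have := (hsub ht hr).length_le
    exact ih _ (by omega) (max r q) (hsr.trans (le_max_left r q)) rfl

theorem exists_card_le_lengths
    (hspecial : ∀ s, ∃ r ≥ s, IsSpecial E e r) (k : ℕ) :
    ∃ s, k ≤ ((candidates E e s).map List.length).toFinset.card := by
  induction k with
  | zero => exact ⟨0, Nat.zero_le _⟩
  | succ k ih =>
    obtain ⟨s, hs⟩ := ih
    obtain ⟨r, hr, hsp⟩ := hspecial s
    refine ⟨r + 1, ?_⟩
    have hnew : ∃ u ∈ candidates E e (r + 1), u.length = (r + 1) ^ 2 := by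
      have hlt : ((strings (r ^ 2)).filter (HasPrefixIn (live E e r) ·)).length
          < (strings (r ^ 2)).length := by
        have := hsp.2
        unfold IsSparse at this
        rw [length_strings]
        omega
      rw [List.length_filter_lt_length_iff_exists] at hlt
      obtain ⟨x, hx, hcov⟩ := hlt
      rw [mem_strings] at hx
      simp only [decide_eq_true_eq] at hcov
      have hlen : (x ++ List.replicate (2 * r + 1) false).length = (r + 1) ^ 2 := by
        simp [hx]; ring
      refine ⟨x ++ List.replicate (2 * r + 1) false,
        mem_candidates.2 ⟨r, r.lt_succ_self, hsp, hlen, ?_⟩, hlen⟩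
      rwa [hasPrefixIn_append _ fun u hu => hx ▸ length_le_of_mem_live hu]
    obtain ⟨u, hu, hul⟩ := hnew
    have hlen : ∀ n ∈ ((candidates E e s).map List.length).toFinset, n < (r + 1) ^ 2 := by
      intro n hn
      simp only [List.mem_toFinset, List.mem_map] at hn
      obtain ⟨v, hv, rfl⟩ := hn
      obtain ⟨j, hj, -, hjl, -⟩ := mem_candidates.1 hv
      rw [hjl]
      gcongr
      omega
    refine (Nat.succ_le_succ hs).trans ?_
    rw [Nat.succ_eq_add_one, ← Finset.card_insert_of_notMem fun h => lt_irrefl _ (hlen ((r + 1) ^ 2) h)]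
    refine Finset.card_le_card fun n hn => ?_
    simp only [Finset.mem_insert, List.mem_toFinset, List.mem_map] at hn ⊢
    rcases hn with rfl | ⟨v, hv, rfl⟩
    · exact ⟨u, hu, hul⟩
    · exact ⟨v, candidates_mono (by omega) hv, rfl⟩

/-- At most a `2⁻ᵐ` fraction of the strings as long as the candidate `u` is live. -/
def IsDepleted (E : ℕ → ℕ → List BinString) (e m s : ℕ) (u : BinString) : Prop :=
  u ∈ candidates E e s ∧
    2 ^ m * ((strings u.length).filter (· ∈ live E e s)).length ≤ 2 ^ u.length

instance (m s : ℕ) (u : BinString) : Decidable (IsDepleted E e m s u) :=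
  inferInstanceAs (Decidable (_ ∧ _))

/-- Kraft's inequality: the live densities at distinct lengths sum to at most 1, so among 2^m
lengths one has density at most 2^(-m). -/
theorem exists_isDepleted (hmono : ∀ s t, s ≤ t → E e s ⊆ E e t)
    (hspecial : ∀ s, ∃ r ≥ s, IsSpecial E e r) (m : ℕ) : ∃ s u, IsDepleted E e m s u := by
  obtain ⟨s, hs⟩ := exists_card_le_lengths hspecial (2 ^ m)
  refine ⟨s, ?_⟩
  by_contra! h
  set N := ((candidates E e s).map List.length).toFinset with hN
  -- Extensions to the common length s² of the live strings of length n.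
  let F (n : ℕ) : Finset BinString := {x ∈ (strings (s ^ 2)).toFinset | x.take n ∈ live E e s}
  have hNle : ∀ n ∈ N, n ≤ s ^ 2 := by
    intro n hn
    simp only [hN, List.mem_toFinset, List.mem_map] at hn
    obtain ⟨v, hv, rfl⟩ := hn
    obtain ⟨j, hj, -, hjl, -⟩ := mem_candidates.1 hv
    rw [hjl]
    gcongr
    omega
  have hF : ∀ n ∈ N, 2 ^ (s ^ 2) < 2 ^ m * (F n).card := by
    intro n hn
    obtain ⟨k, hk⟩ := Nat.exists_eq_add_of_le (hNle n hn)
    simp only [hN, List.mem_toFinset, List.mem_map] at hn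
    obtain ⟨u, hu, rfl⟩ := hn
    have hu' := h u
    simp only [IsDepleted, hu, true_and, not_le] at hu'
    have hcongr : (strings u.length).filter (fun x => x.take u.length ∈ live E e s) =
        (strings u.length).filter (· ∈ live E e s) := by
      refine List.filter_congr fun x hx => ?_
      rw [mem_strings] at hx
      rw [List.take_of_length_le hx.le]
    rw [card_filter_strings, hk, length_filter_strings_add
      (fun x => x.take u.length ∈ live E e s)
      (fun x b hx => by rw [List.take_append_of_le_length hx]), hcongr, pow_add]
    have := Nat.mul_lt_mul_of_pos_left hu' (Nat.two_pow_pos k)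
    linarith
  have hdisj : (N : Set ℕ).PairwiseDisjoint F := by
    have key : ∀ i ∈ N, ∀ j ∈ N, ∀ x, x ∈ F i → x ∈ F j → ¬ i < j := by
      intro i hi j hj x hxi hxj hij
      simp only [F, Finset.mem_filter, List.mem_toFinset, mem_strings] at hxi hxj
      have := hNle i hi
      have := hNle j hj
      refine not_prefix_of_mem_live hmono hxi.2 hxj.2 ?_ ?_
      · simp only [List.length_take, hxi.1]; omega
      · exact List.take_prefix_take_left hij.le
    intro i hi j hj hij
    refine Finset.disjoint_left.2 fun x hxi hxj => ?_
    rcases lt_or_gt_of_ne hij with h' | h'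
    · exact key i hi j hj x hxi hxj h'
    · exact key j hj i hi x hxj hxi h'
  have hle : ∑ n ∈ N, (F n).card ≤ 2 ^ (s ^ 2) := by
    rw [← Finset.card_biUnion hdisj]
    calc _ ≤ (strings (s ^ 2)).toFinset.card :=
          Finset.card_le_card (Finset.biUnion_subset.2 fun n _ => Finset.filter_subset _ _)
      _ = 2 ^ (s ^ 2) := by
          rw [List.toFinset_card_of_nodup (nodup_strings _), length_strings]
  have hNne : N.Nonempty := Finset.card_pos.1 ((Nat.two_pow_pos m).trans_le hs)
  have hlt : ∑ _n ∈ N, 2 ^ (s ^ 2) < ∑ n ∈ N, 2 ^ m * (F n).card :=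
    Finset.sum_lt_sum_of_nonempty hNne hF
  rw [← Finset.mul_sum, Finset.sum_const, smul_eq_mul] at hlt
  have h₁ := Nat.mul_le_mul_right (2 ^ (s ^ 2)) hs
  have h₂ := Nat.mul_le_mul_left (2 ^ m) hle
  omega

/-- Elements of `T` in the band just below `u` are uncovered; padded with zeros, they become
distinct candidates that stay live because `T` is prefix-free. Depletion therefore bounds their
number. -/
theorem IsDepleted.card_lt {T : Set BinString} (hT : IsPrefixFreeSet T)
    (hE : ∀ s, ∀ z ∈ E e s, z ∈ T) (hplay : ∀ z ∈ T, Playable E z) {s : ℕ} {u : BinString}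
    (h : IsDepleted E e (2 * e + 1) s u) (Y : Finset BinString)
    (hY : ∀ y ∈ Y, y ∈ T ∧ y.length < u.length) : Y.card < 2 ^ (u.length - 2 * e) := by
  obtain ⟨hu, hcount⟩ := h
  obtain ⟨j, hjs, hjsp, hjl, -⟩ := mem_candidates.1 hu
  have hej : e ≤ j := hjsp.1 ▸ Nat.unpair_left_le j
  have hshort : {y ∈ Y | y.length < j ^ 2}.card < 2 ^ (j ^ 2) :=
    card_le_of_length_lt _ fun y hy => (Finset.mem_filter.1 hy).2
  let pad (y : BinString) : BinString := y ++ List.replicate (u.length - y.length) false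
  have hlong : {y ∈ Y | ¬ y.length < j ^ 2}.card ≤
      ((strings u.length).filter (· ∈ live E e s)).length := by
    rw [← card_filter_strings]
    have hpad : ∀ y ∈ Y, (pad y).length = u.length := fun y hy => by
      have := (hY y hy).2
      simp only [pad, List.length_append, List.length_replicate]
      omega
    refine Finset.card_le_card_of_injOn pad ?_ ?_
    · intro y hy
      simp only [Finset.coe_filter, Set.mem_ofPred_eq, not_lt, List.mem_toFinset,
        mem_strings] at hy ⊢
      have hyT := hY y hy.1
      refine ⟨hpad y hy.1, mem_unblocked.2 ⟨mem_candidates.2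
        ⟨j, hjs, hjsp, (hpad y hy.1).trans hjl, ?_⟩, ?_⟩⟩
      · have hp := (playable_iff hy.2 (hjl ▸ hyT.2)).1 (hplay y hyT.1)
        rw [hjsp.1] at hp
        rw [hasPrefixIn_append _ fun v hv => (length_le_of_mem_live hv).trans hy.2]
        exact hp.1 hjsp.2
      · rintro ⟨z, hz, hpz⟩
        have hyz : y <+: z := (List.prefix_append _ _).trans hpz
        have hyz' := hT y hyT.1 z (hE s z hz) hyz
        have := hpz.length_le
        rw [hpad y hy.1, ← hyz'] at this
        omega
    · intro y hy y' hy' heq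
      simp only [Finset.coe_filter, Set.mem_ofPred_eq] at hy hy'
      have h₁ : y <+: pad y := List.prefix_append _ _
      have h₂ : y' <+: pad y := heq ▸ List.prefix_append _ _
      rcases List.prefix_or_prefix_of_prefix h₁ h₂ with h | h
      · exact hT _ (hY y hy.1).1 _ (hY y' hy'.1).1 h
      · exact (hT _ (hY y' hy'.1).1 _ (hY y hy.1).1 h).symm
  have hcard := Finset.card_filter_add_card_filter_not (s := Y) (fun y => y.length < j ^ 2)
  -- As e ≤ j, both the strings shorter than j² and those in the band are at most 2^(|u|-2e-1) in
  -- number, the former strictly fewer.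
  have hlen : j ^ 2 + 1 + 2 * e ≤ u.length := by rw [hjl]; nlinarith
  obtain ⟨L, hL⟩ := Nat.exists_eq_add_of_le hlen
  have hsub : u.length - 2 * e = j ^ 2 + L + 1 := by omega
  have hpow : 2 ^ u.length = 2 ^ (2 * e + 1) * 2 ^ (j ^ 2 + L) := by
    rw [← pow_add]; congr 1; omega
  rw [hpow] at hcount
  have hc := Nat.le_of_mul_le_mul_left hcount (Nat.two_pow_pos _)
  have hj : 2 ^ (j ^ 2) ≤ 2 ^ (j ^ 2 + L) := Nat.pow_le_pow_right (by omega) (by omega)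
  rw [hsub, pow_succ]
  omega

end

/-! ### Primitive recursiveness of the construction -/

section

theorem primrec_strings : Primrec strings := by
  have : Primrec₂ fun (_ : ℕ) (l : List BinString) =>
      l.flatMap fun x => [x ++ [false], x ++ [true]] := by
    refine Primrec.list_flatMap Primrec.snd ?_
    refine Primrec.list_cons.comp₂ ?_ (Primrec.list_cons.comp₂ ?_ (Primrec₂.const []))
    · exact Primrec.list_concat.comp₂ Primrec₂.right (Primrec₂.const false)
    · exact Primrec.list_concat.comp₂ Primrec₂.right (Primrec₂.const true)
  refine (Primrec.nat_rec₁ [[]] this).of_eq fun n => ?_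
  induction n with
  | zero => rfl
  | succ n ih => simp only [strings, ← ih]

theorem primrecRel_prefix : PrimrecRel fun u x : BinString => u <+: x := by
  have : PrimrecRel fun u x : BinString => u = x.take u.length :=
    Primrec.eq.comp₂ Primrec₂.left
      (Primrec.list_take.comp₂ (Primrec.list_length.comp₂ Primrec₂.left) Primrec₂.right)
  exact this.of_eq fun u x => List.prefix_iff_eq_take.symm

theorem primrecRel_hasPrefixIn : PrimrecRel HasPrefixIn :=
  primrecRel_prefix.exists_mem_list

theorem primrecRel_hasExtensionIn : PrimrecRel HasExtensionIn := 
  PrimrecRel.exists_mem_list (R := fun z u : BinString => u <+: z)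
    (primrecRel_prefix.comp₂ Primrec₂.right Primrec₂.left)

theorem primrec_nat_pow : Primrec₂ ((· ^ ·) : ℕ → ℕ → ℕ) :=
  Primrec₂.unpaired'.1 Nat.Primrec.pow

theorem primrecRel_isSparse : PrimrecRel IsSparse := by
  have hfilter : Primrec₂ fun (n : ℕ) (l : List BinString) =>
      (strings n).filter (HasPrefixIn l ·) :=
    (PrimrecRel.listFilter primrecRel_hasPrefixIn.swap).comp₂
      (primrec_strings.comp₂ Primrec₂.left) Primrec₂.right
  exact Primrec.nat_lt.comp₂
    (Primrec.nat_mul.comp₂ (Primrec₂.const 2) (Primrec.list_length.comp₂ hfilter))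
    (primrec_nat_pow.comp₂ (Primrec₂.const 2) Primrec₂.left)

theorem primrec_unblocked : Primrec₂ unblocked :=
  PrimrecRel.listFilter (PrimrecRel.not primrecRel_hasExtensionIn).swap

variable {E : ℕ → ℕ → List BinString}

theorem primrec_candidates (hE : Primrec₂ E) : Primrec₂ (candidates E) := by
  have hs : Primrec₂ fun (_ : ℕ) (p : ℕ × List BinString) => p.1 := Primrec.fst.comp₂ Primrec₂.right
  have hlive : Primrec₂ fun (e : ℕ) (p : ℕ × List BinString) => unblocked p.2 (E e p.1) :=
    primrec_unblocked.comp₂ (Primrec.snd.comp₂ Primrec₂.right) (hE.comp₂ Primrec₂.left hs)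
  have hnew : Primrec₂ fun (e : ℕ) (p : ℕ × List BinString) =>
      (strings ((p.1 + 1) ^ 2)).filter fun x => ¬ HasPrefixIn (unblocked p.2 (E e p.1)) x :=
    (PrimrecRel.listFilter (PrimrecRel.not primrecRel_hasPrefixIn).swap).comp₂
      (primrec_strings.comp₂ (primrec_nat_pow.comp₂ (Primrec.succ.comp₂ hs) (Primrec₂.const 2)))
      hlive
  have hcond : PrimrecRel fun (e : ℕ) (p : ℕ × List BinString) =>
      p.1.unpair.1 = e ∧ IsSparse (p.1 ^ 2) (unblocked p.2 (E e p.1)) := by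
    refine PrimrecPred.and ?_ ?_
    · exact Primrec.eq.comp₂ (Primrec.fst.comp₂ (Primrec.unpair.comp₂ hs)) Primrec₂.left
    · exact primrecRel_isSparse.comp₂ (primrec_nat_pow.comp₂ hs (Primrec₂.const 2)) hlive
  have hstep : Primrec₂ fun (e : ℕ) (p : ℕ × List BinString) =>
      if p.1.unpair.1 = e ∧ IsSparse (p.1 ^ 2) (unblocked p.2 (E e p.1)) then
        p.2 ++ (strings ((p.1 + 1) ^ 2)).filter
          fun x => ¬ HasPrefixIn (unblocked p.2 (E e p.1)) x
      else p.2 :=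
    Primrec.ite hcond
      (Primrec.list_append.comp₂ (Primrec.snd.comp₂ Primrec₂.right) hnew)
      (Primrec.snd.comp₂ Primrec₂.right)
  refine (Primrec.nat_rec (Primrec.const []) hstep).of_eq fun e s => ?_
  induction s with
  | zero => rfl
  | succ s ih => simp only [candidates, ← ih]

theorem primrec_live (hE : Primrec₂ E) : Primrec₂ (live E) :=
  primrec_unblocked.comp₂ (primrec_candidates hE) hE

theorem primrecPred_playable (hE : Primrec₂ E) : PrimrecPred (Playable E) := by
  have hs : Primrec fun y : BinString => y.length.sqrt :=
    Primrec.nat_sqrt.comp Primrec.list_length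
  have hlive : Primrec fun y : BinString => live E y.length.sqrt.unpair.1 y.length.sqrt :=
    (primrec_live hE).comp (Primrec.fst.comp (Primrec.unpair.comp hs)) hs
  have hsparse : PrimrecPred fun y : BinString => IsSparse (y.length.sqrt ^ 2)
      (live E y.length.sqrt.unpair.1 y.length.sqrt) :=
    primrecRel_isSparse.comp (primrec_nat_pow.comp hs (Primrec.const 2)) hlive
  have hcov : PrimrecPred fun y : BinString => HasPrefixIn
      (live E y.length.sqrt.unpair.1 y.length.sqrt) y :=
    primrecRel_hasPrefixIn.comp hlive Primrec.id
  refine ((hsparse.and hcov.not).or (hsparse.not.and hcov)).of_eq fun y => ?_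
  unfold Playable
  tauto

end

/-! ### Enumerating the domains of programs -/

open Encodable Denumerable
open Nat.Partrec (Code)

theorem exists_code_of_isDecompressor {D : BinString →. BinString} (hD : IsDecompressor D) :
    ∃ c : Code, ∀ x : BinString, c.eval (encode x) = (D x).map encode := by
  obtain ⟨c, hc⟩ := Code.exists_code.1 hD
  exact ⟨c, fun x => by simp [hc]⟩

/-- The strings on which program number `e.unpair.1` is seen to halt within `s` steps. -/
def domainApprox (e s : ℕ) : List BinString :=
  (List.range s).filterMap fun n => (decode n : Option BinString).bind fun z =>
    if (Code.evaln s (ofNat Code e.unpair.1) (encode z)).isSome then some z else none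

theorem primrec_domainApprox : Primrec₂ domainApprox := by
  have heval : Primrec fun q : ((ℕ × ℕ) × ℕ) × BinString =>
      Code.evaln q.1.1.2 (ofNat Code q.1.1.1.unpair.1) (encode q.2) :=
    Code.primrec_evaln.comp <| Primrec.pair
      (Primrec.pair (Primrec.snd.comp (Primrec.fst.comp Primrec.fst))
        ((Primrec.ofNat Code).comp
          (Primrec.fst.comp (Primrec.unpair.comp
            (Primrec.fst.comp (Primrec.fst.comp Primrec.fst))))))
      (Primrec.encode.comp Primrec.snd)
  have hsome : PrimrecPred fun q : ((ℕ × ℕ) × ℕ) × BinString =>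
      (Code.evaln q.1.1.2 (ofNat Code q.1.1.1.unpair.1) (encode q.2)).isSome = true :=
    Primrec.eq.comp (Primrec.option_isSome.comp heval) (Primrec.const true)
  exact Primrec.listFilterMap (Primrec.list_range.comp Primrec.snd)
    (Primrec.option_bind (Primrec.decode.comp Primrec.snd)
      (Primrec.ite hsome (Primrec.option_some.comp Primrec.snd) (Primrec.const none)))

theorem mem_domainApprox {e s : ℕ} {z : BinString} :
    z ∈ domainApprox e s ↔
      (Code.evaln s (ofNat Code e.unpair.1) (encode z)).isSome := by
  simp only [domainApprox, List.mem_filterMap, List.mem_range, Option.bind_eq_some_iff]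
  constructor
  · rintro ⟨n, -, z', -, h⟩
    split_ifs at h with hn
    rwa [Option.some_inj.1 h] at hn
  · intro h
    obtain ⟨v, hv⟩ := Option.isSome_iff_exists.1 h
    exact ⟨encode z, Code.evaln_bound hv, z, encodek z, by simp [h]⟩

theorem domainApprox_mono (e s t : ℕ) (h : s ≤ t) : domainApprox e s ⊆ domainApprox e t := by
  intro z hz
  rw [mem_domainApprox, Option.isSome_iff_exists] at *
  obtain ⟨v, hv⟩ := hz
  exact ⟨v, Code.evaln_mono h hv⟩

/-- The free parameter `q` lets the game number of a given program be taken arbitrarily large. -/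
theorem mem_dom_iff_exists_domainApprox {V : BinString →. BinString} {c : Code}
    (hc : ∀ x : BinString, c.eval (encode x) = (V x).map encode) (q : ℕ) (z : BinString) :
    z ∈ V.Dom ↔ ∃ s, z ∈ domainApprox (Nat.pair (encode c) q) s := by
  have : z ∈ V.Dom ↔ (c.eval (encode z)).Dom := by rw [hc]; rfl
  rw [this, Part.dom_iff_mem]
  simp only [mem_domainApprox, Nat.unpair_pair, Denumerable.ofNat_encode,
    Option.isSome_iff_exists, Code.evaln_complete]
  exact exists_comm

/-! ### Tagged strings and the optimal plain machine -/

/-- The string `1ⁿ0y`. -/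
def tag (n : ℕ) (y : BinString) : BinString := List.replicate n true ++ false :: y

@[simp] theorem length_tag (n : ℕ) (y : BinString) : (tag n y).length = n + 1 + y.length := by
  simp [tag]; omega

@[simp] theorem idxOf_tag (n : ℕ) (y : BinString) : (tag n y).idxOf false = n := by
  induction n with
  | zero => simp [tag]
  | succ n ih => simpa [tag, List.replicate_succ, List.idxOf_cons_ne] using ih

@[simp] theorem drop_tag (n : ℕ) (y : BinString) : (tag n y).drop (n + 1) = y := by
  simp [tag, List.drop_append]

theorem tag_injective (n : ℕ) : Function.Injective (tag n) := fun x y h => by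
  rw [← drop_tag n x, h, drop_tag]

theorem exists_length_le_of_descComplexity_le {D : BinString →. BinString} {n : ℕ} {x : BinString}
    (h : descComplexity D x ≤ n) : ∃ y, x ∈ D y ∧ y.length ≤ n := by
  by_contra! hlt
  have : ((n + 1 : ℕ) : ℕ∞) ≤ descComplexity D x :=
    le_iInf₂ fun y hy => by exact_mod_cast hlt y hy
  exact absurd (this.trans h) (by norm_cast; omega)

theorem descComplexity_le {D : BinString →. BinString} {x y : BinString} (h : x ∈ D y) :
    descComplexity D x ≤ y.length :=
  iInf₂_le y h

theorem descComplexity_le_add_of_forall {D D' : BinString →. BinString} {c : ℕ} {x : BinString}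
    (h : ∀ z, x ∈ D' z → ∃ y, x ∈ D y ∧ y.length ≤ z.length + c) :
    descComplexity D x ≤ descComplexity D' x + c := by
  by_cases htop : descComplexity D' x = ⊤
  · simp [htop]
  · obtain ⟨n, hn⟩ := ENat.ne_top_iff_exists.1 htop
    obtain ⟨z, hz, hzn⟩ := exists_length_le_of_descComplexity_le hn.ge
    obtain ⟨y, hy, hyz⟩ := h z hz
    rw [← hn]
    exact (descComplexity_le hy).trans (by exact_mod_cast hyz.trans (by omega))

/-- The machine applying program number `n` to `y` on input `1ⁿ0y`. -/
def universal (x : BinString) : Part BinString :=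
  ((ofNat Code (x.idxOf false)).eval (encode (x.drop (x.idxOf false + 1)))).bind
    fun n => (decode n : Option BinString)

theorem partrec_universal : Partrec universal := by
  have hidx : Primrec fun x : BinString => x.idxOf false :=
    Primrec.list_idxOf.comp (Primrec.const false) Primrec.id
  have harg : Primrec fun x : BinString => encode (x.drop (x.idxOf false + 1)) :=
    Primrec.encode.comp (Primrec.list_drop.comp (Primrec.succ.comp hidx) Primrec.id)
  exact (Code.eval_part.comp ((Primrec.ofNat Code).comp hidx).to_comp harg.to_comp).bind
    (Computable.ofOption (Computable.decode.comp Computable.snd)).to₂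

theorem universal_tag {D : BinString →. BinString} {c : Code}
    (hc : ∀ x : BinString, c.eval (encode x) = (D x).map encode) (y : BinString) :
    universal (tag (encode c) y) = D y := by
  simp only [universal, idxOf_tag, drop_tag, Denumerable.ofNat_encode, hc, Part.bind_map, encodek]
  exact Part.bind_some_right _

/-- The optimal machine with domain contained in the playable strings: the playable string of
rank `i` among those of length `n` is treated as the `i`-th string of length `n - 1`. -/
def playableMachine (E : ℕ → ℕ → List BinString) (y : BinString) : Part BinString :=
  ((if Playable E y then
    (strings (y.length - 1))[((strings y.length).filter (Playable E ·)).idxOf y]?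
    else none : Option BinString) : Part BinString).bind universal

theorem partrec_playableMachine {E : ℕ → ℕ → List BinString} (hE : Primrec₂ E) :
    Partrec (playableMachine E) := by
  have hplay := primrecPred_playable hE
  have hrank : Primrec fun y : BinString =>
      ((strings y.length).filter (Playable E ·)).idxOf y :=
    (Primrec.list_idxOf.comp Primrec.id
      ((Primrec.listFilter hplay).comp (primrec_strings.comp Primrec.list_length))).of_eq
      fun y => by congr 1; exact lawful_beq_subsingleton _ _
  have hopt : Primrec fun y : BinString => (if Playable E y then
    (strings (y.length - 1))[((strings y.length).filter (Playable E ·)).idxOf y]?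
    else none : Option BinString) :=
    Primrec.ite hplay (Primrec.list_getElem?.comp (primrec_strings.comp
      (Primrec.pred.comp Primrec.list_length)) hrank) (Primrec.const none)
  exact (Computable.ofOption hopt.to_comp).bind (partrec_universal.comp Computable.snd).to₂

theorem playable_of_mem_dom {E : ℕ → ℕ → List BinString} {y : BinString}
    (h : y ∈ PFun.Dom (playableMachine E)) : Playable E y := by
  by_contra hy
  obtain ⟨x, hx⟩ := (PFun.mem_dom _ _).1 h
  simp [playableMachine, hy] at hx

theorem exists_playableMachine_eq (E : ℕ → ℕ → List BinString) (x : BinString) :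
    ∃ y, y.length = x.length + 1 ∧ playableMachine E y = universal x := by
  set l := (strings (x.length + 1)).filter (Playable E ·) with hl
  obtain ⟨i, hi, hix⟩ := List.getElem_of_mem (mem_strings.2 (rfl : x.length = x.length))
  have hil : i < l.length := by
    have := two_pow_le_length_filter_playable (E := E) (x.length + 1)
    rw [length_strings] at hi
    rw [pow_succ, ← hl] at this
    omega
  have hmem : l[i] ∈ l := List.getElem_mem hil
  have hmem' : l[i].length = x.length + 1 ∧ Playable E l[i] := by
    simpa only [hl, List.mem_filter, mem_strings, decide_eq_true_eq] using hmem
  refine ⟨l[i], hmem'.1, ?_⟩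
  have hidx : l.idxOf l[i] = i := ((nodup_strings _).filter _).idxOf_getElem i hil
  simp only [playableMachine, hmem'.2, if_true, hmem'.1]
  rw [← hl, hidx, Nat.add_sub_cancel, List.getElem?_eq_getElem hi, hix]
  simp

theorem isOptimalDecompressor_playableMachine {E : ℕ → ℕ → List BinString} (hE : Primrec₂ E) :
    IsOptimalDecompressor (playableMachine E) := by
  refine ⟨partrec_playableMachine hE, fun D' hD' => ?_⟩
  obtain ⟨c, hc⟩ := exists_code_of_isDecompressor hD'
  -- The tag costs `encode c + 1` bits and the passage to playable strings one more.
  refine ⟨encode c + 2, fun x => descComplexity_le_add_of_forall fun z hz => ?_⟩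
  obtain ⟨y, hy, hyx⟩ := exists_playableMachine_eq E (tag (encode c) z)
  refine ⟨y, by rwa [hyx, universal_tag hc], ?_⟩
  rw [hy, length_tag]
  omega

/-! ### Short descriptions forced by prefix-free optimality -/

/-- The identity map on the strings `1ⁿ0y` with `|y| = f n`. -/
def tagMachine (f : ℕ →. ℕ) (x : BinString) : Part BinString :=
  (f (x.idxOf false)).bind fun m =>
    ((if x.length = x.idxOf false + 1 + m then some x else none : Option BinString) :
      Part BinString)

theorem mem_tagMachine {f : ℕ →. ℕ} {x y : BinString} :
    y ∈ tagMachine f x ↔ ∃ m ∈ f (x.idxOf false), x.length = x.idxOf false + 1 + m ∧ y = x := by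
  simp only [tagMachine, Part.mem_bind_iff]
  refine exists_congr fun m => and_congr_right fun _ => ?_
  split_ifs with h <;> simp [h, eq_comm]

theorem isPrefixFreeDecompressor_tagMachine {f : ℕ →. ℕ} (hf : Partrec f) :
    IsPrefixFreeDecompressor (tagMachine f) := by
  have hidx : Primrec fun x : BinString => x.idxOf false :=
    Primrec.list_idxOf.comp (Primrec.const false) Primrec.id
  constructor
  · refine (hf.comp hidx.to_comp).bind (Computable.ofOption (f := fun p : BinString × ℕ =>
      if p.1.length = p.1.idxOf false + 1 + p.2 then some p.1 else none) (Primrec.to_comp ?_)).to₂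
    refine Primrec.ite (Primrec.eq.comp (Primrec.list_length.comp Primrec.fst) ?_)
      (Primrec.option_some.comp Primrec.fst) (Primrec.const none)
    exact Primrec.nat_add.comp (Primrec.succ.comp (hidx.comp Primrec.fst)) Primrec.snd
  · intro u hu v hv huv
    obtain ⟨_, hu⟩ := (PFun.mem_dom _ _).1 hu
    obtain ⟨_, hv⟩ := (PFun.mem_dom _ _).1 hv
    obtain ⟨m, hm, hul, -⟩ := mem_tagMachine.1 hu
    obtain ⟨m', hm', hvl, -⟩ := mem_tagMachine.1 hv
    have hidx : v.idxOf false = u.idxOf false := by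
      obtain ⟨t, rfl⟩ := huv
      -- The length condition excludes all-ones strings, so `u` contains a zero and its extension
      -- has the same tag.
      refine List.idxOf_append_of_mem (List.idxOf_lt_length_iff.1 ?_)
      omega
    rw [hidx] at hm' hvl
    rw [Part.mem_unique hm' hm] at hvl
    exact huv.eq_of_length (hul.trans hvl.symm)

/-- The 2^m tagged strings describe themselves under `tagMachine f`; optimality gives them distinct
`V`-descriptions at most `c` longer. -/
theorem IsOptimalPrefixFreeDecompressor.exists_many_short {V : BinString →. BinString}
    (hV : IsOptimalPrefixFreeDecompressor V) {f : ℕ →. ℕ} (hf : Partrec f) :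
    ∃ c : ℕ, ∀ n, ∀ m ∈ f n, ∃ Y : Finset BinString, 2 ^ m ≤ Y.card ∧
      ∀ y ∈ Y, y ∈ V.Dom ∧ y.length ≤ n + 1 + m + c := by
  obtain ⟨c, hc⟩ := hV.2 _ (isPrefixFreeDecompressor_tagMachine hf)
  refine ⟨c, fun n m hm => ?_⟩
  have hdesc : ∀ x ∈ strings m, ∃ y, tag n x ∈ V y ∧ y.length ≤ n + 1 + m + c := by
    intro x hx
    rw [mem_strings] at hx
    refine exists_length_le_of_descComplexity_le ((hc _).trans ?_)
    have : tag n x ∈ tagMachine f (tag n x) :=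
      mem_tagMachine.2 ⟨m, by simpa using hm, by simp [hx], rfl⟩
    refine (add_le_add_left (descComplexity_le this) _).trans ?_
    simp [hx]
  choose! g hg hgl using hdesc
  refine ⟨(strings m).toFinset.image g, ?_, ?_⟩
  · rw [Finset.card_image_of_injOn, List.toFinset_card_of_nodup (nodup_strings m), length_strings]
    intro x hx y hy hxy
    simp only [List.coe_toFinset, Set.mem_ofPred_eq] at hx hy
    have hy' := hg y hy
    rw [← hxy] at hy'
    exact tag_injective n (Part.mem_unique (hg x hx) hy')
  · intro y hy
    simp only [Finset.mem_image, List.mem_toFinset] at hy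
    obtain ⟨x, hx, rfl⟩ := hy
    exact ⟨(PFun.mem_dom _ _).2 ⟨_, hg x hx⟩, hgl x hx⟩

/-! ### Computing a depleted length and the contradiction -/

/-- A search for a depleted candidate `u` of game `e`, returning `|u| - 2e`. -/
def depletedLength (E : ℕ → ℕ → List BinString) (e : ℕ) : Part ℕ :=
  Nat.rfindOpt fun t => (decode t : Option (ℕ × BinString)).bind fun p =>
    if IsDepleted E e (2 * e + 1) p.1 p.2 then some (p.2.length - 2 * e) else none

theorem partrec_depletedLength {E : ℕ → ℕ → List BinString} (hE : Primrec₂ E) :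
    Partrec (depletedLength E) := by
  have hmem : PrimrecRel fun (u : BinString) (l : List BinString) => u ∈ l := by
    refine (PrimrecRel.swap (PrimrecRel.exists_mem_list (Primrec.eq (α := BinString)))).of_eq
      fun u l => ?_
    simp [Function.swap]
  have hcount : Primrec₂ fun (n : ℕ) (l : List BinString) =>
      ((strings n).filter (· ∈ l)).length :=
    Primrec.list_length.comp₂
      ((PrimrecRel.listFilter hmem).comp₂ (primrec_strings.comp₂ Primrec₂.left) Primrec₂.right)
  have he : Primrec fun q : (ℕ × ℕ) × (ℕ × BinString) => q.1.1 := Primrec.fst.comp Primrec.fst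
  have hs : Primrec fun q : (ℕ × ℕ) × (ℕ × BinString) => q.2.1 := Primrec.fst.comp Primrec.snd
  have hu : Primrec fun q : (ℕ × ℕ) × (ℕ × BinString) => q.2.2 := Primrec.snd.comp Primrec.snd
  have hlen : Primrec fun q : (ℕ × ℕ) × (ℕ × BinString) => q.2.2.length :=
    Primrec.list_length.comp hu
  have hdep : PrimrecPred fun q : (ℕ × ℕ) × (ℕ × BinString) =>
      IsDepleted E q.1.1 (2 * q.1.1 + 1) q.2.1 q.2.2 := by
    refine PrimrecPred.and (hmem.comp hu ((primrec_candidates hE).comp he hs))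
      (Primrec.nat_le.comp (Primrec.nat_mul.comp ?_ ?_) ?_)
    · exact primrec_nat_pow.comp (Primrec.const 2) (Primrec.nat_double_succ.comp he)
    · exact hcount.comp hlen ((primrec_live hE).comp he hs)
    · exact primrec_nat_pow.comp (Primrec.const 2) hlen
  refine Partrec.rfindOpt (Primrec.to_comp ?_)
  refine Primrec.option_bind (Primrec.decode.comp Primrec.snd) ?_
  exact Primrec.ite hdep
    (Primrec.option_some.comp (Primrec.nat_sub.comp hlen (Primrec.nat_double.comp he)))
    (Primrec.const none)

theorem exists_mem_depletedLength {E : ℕ → ℕ → List BinString} {e : ℕ}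
    (h : ∃ s u, IsDepleted E e (2 * e + 1) s u) :
    ∃ s u, IsDepleted E e (2 * e + 1) s u ∧ u.length - 2 * e ∈ depletedLength E e := by
  obtain ⟨s, u, h⟩ := h
  have hdom : (depletedLength E e).Dom :=
    Nat.rfindOpt_dom.2 ⟨encode (s, u), u.length - 2 * e, by simp [h]⟩
  obtain ⟨m, hm⟩ := Part.dom_iff_mem.1 hdom
  obtain ⟨t, ht⟩ := Nat.rfindOpt_spec hm
  simp only [Option.mem_def, Option.bind_eq_some_iff] at ht
  obtain ⟨⟨s', u'⟩, -, ht⟩ := ht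
  split_ifs at ht with hdep
  exact ⟨s', u', hdep, by rwa [Option.some_inj.1 ht]⟩

theorem not_forall_mem_dom_playable {V : BinString →. BinString}
    (hV : IsOptimalPrefixFreeDecompressor V) :
    ¬ ∀ z ∈ V.Dom, Playable domainApprox z := by
  intro hplay
  obtain ⟨c, hc⟩ := exists_code_of_isDecompressor hV.1.1
  obtain ⟨c₁, hc₁⟩ := hV.exists_many_short (f := fun s => Part.some (s ^ 2))
    (Primrec.to_comp (primrec_nat_pow.comp Primrec.id (Primrec.const 2))).partrec
  obtain ⟨c₂, hc₂⟩ := hV.exists_many_short (partrec_depletedLength primrec_domainApprox)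
  -- Neither constant depends on the game number, so `e` can be chosen beyond both: the bands need
  -- c₁ < e, the final count c₂ + 1 < e.
  set q := c₁ + c₂ + 2 with hq
  set e := Nat.pair (encode c) q with he
  have hqe : q ≤ e := Nat.right_le_pair _ _
  have hdom := mem_dom_iff_exists_domainApprox hc q
  rw [← he] at hdom
  have hmono := domainApprox_mono e
  -- Among 2^(s²) descriptions of length at most s² + s + 1 + c₁ < (s+1)², not all are shorter than
  -- s².
  have hband : ∀ s ≥ e, ∃ z ∈ V.Dom, s ^ 2 ≤ z.length ∧ z.length < (s + 1) ^ 2 := by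
    intro s hs
    obtain ⟨Y, hYcard, hY⟩ := hc₁ s _ (Part.mem_some _)
    by_contra! h
    refine (card_le_of_length_lt Y fun y hy => ?_).not_ge hYcard
    by_contra! hlong
    have := h y (hY y hy).1 hlong
    have := (hY y hy).2
    nlinarith
  have hspecial := exists_isSpecial hmono (fun z hz => (hdom z).1 hz) hplay hband
  obtain ⟨s, u, hdep, hmem⟩ :=
    exists_mem_depletedLength (exists_isDepleted hmono hspecial (2 * e + 1))
  obtain ⟨Y, hYcard, hY⟩ := hc₂ e _ hmem
  -- Ensures that the natural subtraction `u.length - 2 * e` is not truncated.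
  have hlen : 2 * e ≤ u.length := by
    obtain ⟨j, -, hj, hjl, -⟩ := mem_candidates.1 hdep.1
    have : e ≤ j := hj.1 ▸ Nat.unpair_left_le j
    rw [hjl]
    nlinarith
  refine (hdep.card_lt hV.1.2 (fun s z hz => (hdom z).2 ⟨s, hz⟩) hplay Y fun y hy => ?_).not_ge
    hYcard
  have := (hY y hy).2
  exact ⟨(hY y hy).1, by omega⟩

theorem theorem1 :
    ∃ D : BinString →. BinString, IsOptimalDecompressor D ∧
      ∀ T : Set BinString, T ⊆ D.Dom →
        ¬ ∃ V : BinString →. BinString, IsOptimalPrefixFreeDecompressor V ∧ V.Dom = T := by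
  refine ⟨playableMachine domainApprox,
    isOptimalDecompressor_playableMachine primrec_domainApprox, ?_⟩
  rintro T hT ⟨V, hV, rfl⟩
  exact not_forall_mem_dom_playable hV fun z hz =>
    playable_of_mem_dom (hT hz)
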